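/- A graph is a finite directed multigraph with at least two vertices and at least two edges; a plane graph is a graph with a topological embedding of its geometric realization into $\mathbb{C}$. Open faces are the connected components of the complement; the unbounded one is the exterior face, the bounded ones are the interior faces. Directed paths have no repeated vertices. A connected plane graph $G$ is \emph{anchored} if it is equipped with (a) for every interior face $F$, distinct vertices $s_F,t_F$ and directed paths $\mathrm{dom}_F,\mathrm{codom}_F$ from $s_F$ to $t_F$ such that the boundary of $F$, traversed with $F$ always on the right-hand side, is $\mathrm{dom}_F$ followed by the reverse of $\mathrm{codom}_F$; (b) distinct vertices $s_G,t_G$ and directed paths $\mathrm{dom}_G,\mathrm{codom}_G$ from $s_G$ to $t_G$ such that the boundary of the exterior face, traversed with that face always on the right-hand side, is $\mathrm{codom}_G$ followed by the reverse of $\mathrm{dom}_G$. An anchored graph is \emph{atomic} if it has exactly one interior face $F$, and $\mathrm{dom}_F$, $\mathrm{codom}_F$ have no edge in common. An atomic graph consists of $F$ together with a directed path $P$ from $s_G$ to $s_F$ and a directed path $P'$ from $t_F$ to $t_G$, so that $\mathrm{dom}_G=P\,\mathrm{dom}_F\,P'$ and $\mathrm{codom}_G=P\,\mathrm{codom}_F\,P'$.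 If $s_G=s_H$, $t_G=t_H$ and $\mathrm{codom}_G=\mathrm{dom}_H$, the \emph{vertical composite} $HG$ is the anchored graph obtained by gluing $G$ and $H$ along $\mathrm{codom}_G=\mathrm{dom}_H$, with the anchored interior faces of $G$ and of $H$, with exterior face the intersection of those of $G$ and $H$, with domain $\mathrm{dom}_G$ and with codomain $\mathrm{codom}_H$ (plane graphs being identified along orientation-preserving homeomorphisms of the plane that preserve vertices, edges and incidence). A \emph{pasting scheme presentation} of $G$ is a decomposition $G=G_n\cdots G_1$, $n\ge 1$, into vertical composites of atomic graphs. A \emph{$G$-diagram} $\phi$ in a 2-category assigns an object $\phi_v$ to every vertex $v$, a 1-cell $\phi_e:\phi_u\to\phi_v$ to every edge $e$ from $u$ to $v$, and a 2-cell $\phi_F:\phi_{\mathrm{dom}_F}\to\phi_{\mathrm{codom}_F}$ to every interior face $F$, where $\phi_Q$ is the composite of the 1-cells along the directed path $Q$. The \emph{composite} of $\phi$ with respect to a presentation $G=G_n\cdots G_1$ is the vertical composite $\phi_{G_n}\cdots\phi_{G_1}:\phi_{\mathrm{dom}_G}\to\phi_{\mathrm{codom}_G}$, where $\phi_{G_i}$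 is the 2-cell of the unique interior face $F_i$ of $G_i$ whiskered with $\phi_{P_i}$ and $\phi_{P_i'}$, for $P_i$ and $P_i'$ the directed paths of $G_i$ from $s_G$ to $s_{F_i}$ and from $t_{F_i}$ to $t_G$. \textbf{Corollary.} Let $G$ be an anchored graph and $\phi$ a $G$-diagram in a 2-category. Then the composites of $\phi$ with respect to any two pasting scheme presentations of $G$ are equal. -/

import Mathlib

open CategoryTheory Bicategory Quiver Topology Filter

universe u v₁ v₂ v₃

namespace Pasting

/-! ### Graphs and directed paths -/

/-- A (finite, directed) graph with at least two vertices and at least two edges. -/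
structure Graph where
  V : Type u
  E : Type u
  [finV : Finite V]
  [finE : Finite E]
  [nontrivialV : Nontrivial V]
  [nontrivialE : Nontrivial E]
  tail : E → V
  head : E → V

namespace Graph

/-- The arrows from `a` to `b` are the edges with tail `a` and head `b`. Elements of
`Quiver.Path a b` are then alternating sequences of vertices and edges, every edge being traversed
from its tail to its head. -/
instance (G : Graph.{u}) : Quiver G.V where
  Hom a b := { e : G.E // G.tail e = a ∧ G.head e = b }

/-- The list of edges of a path, in order. -/
def edges {G : Graph.{u}} {a : G.V} : ∀ {b : G.V}, Path a b → List G.E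
  | _, .nil => []
  | _, .cons p e => edges p ++ [e.1]

/-- Any two vertices are joined by a sequence of edges, traversed in either direction. -/
def IsConnected (G : Graph.{u}) : Prop :=
  ∀ a b : G.V, Relation.ReflTransGen
    (fun x y => ∃ e : G.E, (G.tail e = x ∧ G.head e = y) ∨ (G.tail e = y ∧ G.head e = x)) a b

/-- The coproduct of a point for every vertex and a copy of `[0,1]` for every edge. -/
abbrev PreRealization (G : Graph.{u}) : Type u :=
  (Σ _ : G.V, PUnit.{u + 1}) ⊕ (Σ _ : G.E, unitInterval)

/-- The identifications of the geometric realization: the endpoint `0` of an edge with its tail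
and the endpoint `1` with its head. -/
inductive Glue (G : Graph.{u}) : G.PreRealization → G.PreRealization → Prop
  | tail (e : G.E) : Glue G (.inr ⟨e, 0⟩) (.inl ⟨G.tail e, PUnit.unit⟩)
  | head (e : G.E) : Glue G (.inr ⟨e, 1⟩) (.inl ⟨G.head e, PUnit.unit⟩)

/-- The geometric realization, with the quotient topology. -/
abbrev Realization (G : Graph.{u}) : Type u := Quot G.Glue

/-- A pair of directed paths (the domain and the codomain) with the same source and the same
sink. -/
structure PathPair (G : Graph.{u}) where
  s : G.V
  t : G.V
  dom : Path s t
  codom : Path s t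

/-- The source and the sink are distinct, and neither path repeats a vertex. -/
structure PathPair.IsProper {G : Graph.{u}} (X : G.PathPair) : Prop where
  ne : X.s ≠ X.t
  dom_nodup : X.dom.vertices.Nodup
  codom_nodup : X.codom.vertices.Nodup

/-- The image of a pair of paths under a morphism of graphs. -/
def PathPair.map {G K : Graph.{u}} (f : G.V ⥤q K.V) (X : G.PathPair) : K.PathPair where
  s := f.obj X.s
  t := f.obj X.t
  dom := f.mapPath X.dom
  codom := f.mapPath X.codom

end Graph

/-! ### Plane graphs and their faces -/

/-- A homeomorphism of the plane is orientation preserving if it is isotopic to the identity. -/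
def OrientationPreserving (h : ℂ ≃ₜ ℂ) : Prop :=
  ∃ H : unitInterval → (ℂ ≃ₜ ℂ), Continuous (fun x : unitInterval × ℂ => H x.1 x.2) ∧
    H 0 = Homeomorph.refl ℂ ∧ H 1 = h

/-- A graph with a topological embedding of its geometric realization into the plane. -/
structure PlaneGraph extends Graph.{u} where
  emb : toGraph.Realization → ℂ
  isEmbedding : IsEmbedding emb

namespace PlaneGraph

variable (G : PlaneGraph.{u})

/-- The point of the plane that represents a vertex. -/
def point (a : G.V) : ℂ := G.emb (Quot.mk _ (.inl ⟨a, PUnit.unit⟩))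

/-- The parametrized curve that represents an edge. -/
def curve (e : G.E) (x : unitInterval) : ℂ := G.emb (Quot.mk _ (.inr ⟨e, x⟩))

/-- An (open) face: a connected component of the complement of the graph. -/
def IsFace (F : Set ℂ) : Prop :=
  ∃ z ∈ (Set.range G.emb)ᶜ, F = connectedComponentIn (Set.range G.emb)ᶜ z

def IsInteriorFace (F : Set ℂ) : Prop := G.IsFace F ∧ Bornology.IsBounded F

def IsExteriorFace (F : Set ℂ) : Prop := G.IsFace F ∧ ¬ Bornology.IsBounded F

/-- The interior faces (distinct open faces have distinct closures). -/
def InteriorFace : Type := { F : Set ℂ // G.IsInteriorFace F }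

/-- The homeomorphism `h` preserves the orientation of the plane and straightens the middle part
of the edge `e`: it becomes a segment of the real axis, traversed from left to right, with the
midpoint of `e` at the origin. -/
def Straightens (h : ℂ ≃ₜ ℂ) (e : G.E) : Prop :=
  OrientationPreserving h ∧
    ∀ x : unitInterval, 1 / 4 ≤ (x : ℝ) → (x : ℝ) ≤ 3 / 4 → h (G.curve e x) = (x : ℝ) - 1 / 2

/-- After straightening `e`, the set `F` contains all points `c₀ * r * i` with `r > 0` small. -/
def OnSide (c₀ : ℝ) (F : Set ℂ) (e : G.E) : Prop :=
  ∃ h : ℂ ≃ₜ ℂ, G.Straightens h e ∧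
    ∀ᶠ r : ℝ in 𝓝[>] 0, h.symm (((c₀ * r : ℝ) : ℂ) * Complex.I) ∈ F

/-- `F` is on the right-hand side when `e` is traversed from its tail to its head. -/
def RightOf (F : Set ℂ) (e : G.E) : Prop := G.OnSide (-1) F e

/-- `F` is on the left-hand side when `e` is traversed from its tail to its head; equivalently,
on the right-hand side when `e` is traversed from its head to its tail. -/
def LeftOf (F : Set ℂ) (e : G.E) : Prop := G.OnSide 1 F e

end PlaneGraph

/-! ### Anchored graphs and atomic graphs -/

/-- A connected plane graph all of whose faces are anchored.

The boundary of an interior face `F`, traversed with `F` on the right-hand side, is `dom_F`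
followed by the reverse of `codom_F`: the edges that are traversed forwards (those with `F` on
their right) are the edges of `dom_F`, and the edges that are traversed backwards (those with `F`
on their left) are the edges of `codom_F`. The boundary of the exterior face is `codom_G` followed
by the reverse of `dom_G`. -/
structure AnchoredGraph extends PlaneGraph.{u} where
  connected : toGraph.IsConnected
  ext : toGraph.PathPair
  ext_proper : ext.IsProper
  mem_ext_codom : ∀ F, toPlaneGraph.IsExteriorFace F →
    ∀ e, e ∈ Graph.edges ext.codom ↔ toPlaneGraph.RightOf F e
  mem_ext_dom : ∀ F, toPlaneGraph.IsExteriorFace F →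
    ∀ e, e ∈ Graph.edges ext.dom ↔ toPlaneGraph.LeftOf F e
  bd : toPlaneGraph.InteriorFace → toGraph.PathPair
  bd_proper : ∀ F, (bd F).IsProper
  mem_bd_dom : ∀ F e, e ∈ Graph.edges (bd F).dom ↔ toPlaneGraph.RightOf F.1 e
  mem_bd_codom : ∀ F e, e ∈ Graph.edges (bd F).codom ↔ toPlaneGraph.LeftOf F.1 e

/-- An atomic graph has exactly one interior face `F`. No edge has `F` on both of its sides, i.e.
`dom_F` and `codom_F` have no edge in common (there are no edges dangling inside `F`). -/
def AnchoredGraph.IsAtomic (G : AnchoredGraph.{u}) : Prop :=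
  ∃ F : G.InteriorFace, (∀ F' : G.InteriorFace, F' = F) ∧
    List.Disjoint (Graph.edges (G.bd F).dom) (Graph.edges (G.bd F).codom)

/-! ### An atomic graph is a face with a path attached at its source and at its sink -/

namespace Graph

variable {G : Graph.{u}}

theorem edges_comp {a b c : G.V} (p : Path a b) (q : Path b c) :
    edges (p.comp q) = edges p ++ edges q := by
  induction q with
  | nil => simp [edges]
  | cons q e ih => simp [edges, ih]

theorem exists_mem_edges {a b : G.V} (p : Path a b) (hp : p.length ≠ 0) : ∃ e, e ∈ edges p := by
  cases p with
  | nil => simp at hp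
  | cons p e => exact ⟨e.1, by simp [edges]⟩

theorem edges_map_tail {a b : G.V} (p : Path a b) :
    (edges p).map G.tail = p.vertices.dropLast := by
  induction p with
  | nil => simp [edges]
  | cons p e ih =>
    simp only [edges, List.map_append, ih, List.map_cons, List.map_nil, e.2.1,
      Path.vertices_cons, List.concat_eq_append, List.dropLast_concat]
    exact p.dropLast_append_end_eq

theorem edges_nodup {a b : G.V} {p : Path a b} (hp : p.vertices.Nodup) : (edges p).Nodup := by
  refine List.Nodup.of_map G.tail ?_
  rw [edges_map_tail]
  exact hp.sublist (List.dropLast_sublist _)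

theorem split_unique {a b c : G.V} {A B : Path a b} {A' B' : Path b c}
    (h : A.comp A' = B.comp B') (hq : (A.comp A').vertices.Nodup) : A = B ∧ A' = B' := by
  have key : A.length = B.length := by
    have h1 : ∃ hl, (A.comp A').vertices.get ⟨A.length, hl⟩ = b :=
      ⟨_, Path.vertices_comp_get_length_eq A A'⟩
    have h2 : ∃ hl, (B.comp B').vertices.get ⟨B.length, hl⟩ = b :=
      ⟨_, Path.vertices_comp_get_length_eq B B'⟩
    rw [← h] at h2
    obtain ⟨_, h1⟩ := h1
    obtain ⟨_, h2⟩ := h2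
    have := (List.Nodup.get_inj_iff hq).1 (h1.trans h2.symm)
    simpa using this
  exact (Path.comp_inj' key).1 h

theorem split_at {a b : G.V} (q : Path a b) {c d : G.V} (e : c ⟶ d) (he : e.1 ∈ edges q) :
    ∃ (P : Path a c) (P' : Path d b), q = (P.cons e).comp P' := by
  induction q with
  | nil => simp [edges] at he
  | cons q f ih =>
    simp only [edges, List.mem_append, List.mem_singleton] at he
    rcases he with he | he
    · obtain ⟨P, P', rfl⟩ := ih he
      exact ⟨P, P'.cons f, rfl⟩
    · obtain ⟨e, he1, he2⟩ := e
      obtain ⟨f, hf1, hf2⟩ := f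
      simp only at he
      subst he he1 he2 hf1
      subst hf2
      exact ⟨q, .nil, rfl⟩

theorem contiguous {a b : G.V} {q : Path a b} (hq : q.vertices.Nodup) {c d : G.V} (p : Path c d)
    (hp : p.length ≠ 0) (h : ∀ e ∈ edges p, e ∈ edges q) :
    ∃ (P : Path a c) (P' : Path d b), q = (P.comp p).comp P' := by
  induction p with
  | nil => simp at hp
  | cons p e ih =>
    obtain ⟨R, R', hR⟩ := split_at q e (h _ (by simp [edges]))
    by_cases h0 : p.length = 0
    · cases p with
      | nil => exact ⟨R, R', hR⟩
      | cons p f => simp at h0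
    · obtain ⟨P, P', hP⟩ := ih h0 (fun f hf => h f (by simp [edges, hf]))
      have hR2 : q = R.comp (e.toPath.comp R') := by
        rw [hR, ← Path.comp_assoc]; rfl
      obtain ⟨h1, -⟩ := split_unique (hP.symm.trans hR2) (hP ▸ hq)
      exact ⟨P, R', by rw [hR, ← h1]; rfl⟩

theorem exists_prefix {a b c : G.V} {q : Path a b} (hq : q.vertices.Nodup) (p : Path a c)
    (h : ∀ e ∈ edges p, e ∈ edges q) : ∃ P' : Path c b, q = p.comp P' := by
  by_cases h0 : p.length = 0
  · cases p with
    | nil => exact ⟨q, by simp⟩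
    | cons p f => simp at h0
  · obtain ⟨P, P', hP⟩ := contiguous hq p h0 h
    have h1 : Path.nil.comp q = P.comp (p.comp P') := by
      rw [Path.nil_comp, ← Path.comp_assoc, ← hP]
    obtain ⟨h2, h3⟩ := split_unique h1 (by rwa [Path.nil_comp])
    exact ⟨P', h3⟩

theorem exists_suffix {a b c : G.V} {q : Path a b} (hq : q.vertices.Nodup) (p : Path c b)
    (h : ∀ e ∈ edges p, e ∈ edges q) : ∃ P : Path a c, q = P.comp p := by
  by_cases h0 : p.length = 0
  · cases p with
    | nil => exact ⟨q, by simp⟩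
    | cons p f => simp at h0
  · obtain ⟨P, P', hP⟩ := contiguous hq p h0 h
    obtain ⟨-, h3⟩ := split_unique (A := q) (A' := Path.nil) hP (by simpa using hq)
    exact ⟨P, by rw [hP, ← h3, Path.comp_nil]⟩

end Graph

theorem PlaneGraph.exists_face_onSide (G : PlaneGraph.{u}) {h : ℂ ≃ₜ ℂ} {e : G.E}
    (hs : G.Straightens h e) {c₀ : ℝ} (hr₀ : c₀ ≠ 0) : ∃ F, G.IsFace F ∧ G.OnSide c₀ F e := by
  have := G.finV
  have := G.finE
  let half : unitInterval := ⟨1 / 2, by norm_num, by norm_num⟩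
  let C : Set G.PreRealization :=
    {x | ∀ y : unitInterval, x = .inr ⟨e, y⟩ → (y : ℝ) ≤ 1 / 4 ∨ 3 / 4 ≤ (y : ℝ)}
  have hC : IsClosed C := by
    rw [isClosed_sum_iff]
    constructor
    · convert isClosed_univ
      ext x
      simp [C]
    · rw [isClosed_sigma_iff]
      intro f
      by_cases hf : f = e
      · subst hf
        have : IsClosed ({y : unitInterval | (y : ℝ) ≤ 1 / 4} ∪ {y | 3 / 4 ≤ (y : ℝ)}) :=
          (isClosed_le (by fun_prop) (by fun_prop)).union
            (isClosed_le (by fun_prop) (by fun_prop))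
        convert this using 1
        ext y
        constructor
        · exact fun hy => hy y rfl
        · intro hy z hz
          cases hz
          exact hy
      · convert isClosed_univ
        ext y
        simp [C, hf]
  let g : G.PreRealization → ℂ := fun x => G.emb (Quot.mk _ x)
  have hg : Continuous g := G.isEmbedding.continuous.comp continuous_quot_mk
  have hgC : IsClosed (g '' C) := (hC.isCompact.image hg).isClosed
  have hmid : ∀ x, g x = G.curve e half → x = .inr ⟨e, half⟩ := by
    intro x hx
    have h1 := G.isEmbedding.injective hx
    let t : G.Realization → Prop := Quot.lift (fun x => x = .inr ⟨e, half⟩) (by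
      rintro _ _ (⟨f⟩ | ⟨f⟩)
      · simp only [reduceCtorEq, eq_iff_iff, iff_false, Sum.inr.injEq, Sigma.mk.injEq, not_and]
        rintro rfl hh
        have := congrArg (fun y : unitInterval => (y : ℝ)) (eq_of_heq hh)
        norm_num [half] at this
      · simp only [reduceCtorEq, eq_iff_iff, iff_false, Sum.inr.injEq, Sigma.mk.injEq, not_and]
        rintro rfl hh
        have := congrArg (fun y : unitInterval => (y : ℝ)) (eq_of_heq hh)
        norm_num [half] at this)
    have h2 : t (Quot.mk _ x) = t (Quot.mk _ (.inr ⟨e, half⟩)) := congrArg t h1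
    have h3 : t (Quot.mk _ (.inr ⟨e, half⟩)) := rfl
    rw [← h2] at h3
    exact h3
  have hnot : G.curve e half ∉ g '' C := by
    rintro ⟨x, hx, hxe⟩
    have := hx half (hmid x hxe)
    norm_num [half] at this
  have h0 : h.symm 0 = G.curve e half := by
    rw [h.symm_apply_eq, hs.2 half (by norm_num [half]) (by norm_num [half])]
    norm_num [half]
  let c : ℝ → ℂ := fun r => h.symm (((c₀ * r : ℝ) : ℂ) * Complex.I)
  have hc : Continuous c := h.symm.continuous.comp (by fun_prop)
  have hc0 : c 0 = G.curve e half := by simp [c, h0]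
  have hev : ∀ᶠ r in 𝓝 (0 : ℝ), c r ∈ (g '' C)ᶜ :=
    hc.continuousAt.eventually_mem (hgC.isOpen_compl.mem_nhds (by rw [hc0]; exact hnot))
  obtain ⟨δ, hδ, hball⟩ := Metric.eventually_nhds_iff.1 hev
  have hoff : ∀ r ∈ Set.Ioo 0 δ, c r ∈ (Set.range G.emb)ᶜ := by
    rintro r ⟨h1, h2⟩ ⟨q, hr⟩
    obtain ⟨x, rfl⟩ := Quot.exists_rep q
    have h3 : x ∉ C := fun hx =>
      hball (y := r) (by simpa [abs_of_pos h1] using h2) ⟨x, hx, hr⟩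
    simp only [C, Set.mem_ofPred_eq, not_forall, not_or, not_le] at h3
    obtain ⟨y, rfl, hy1, hy2⟩ := h3
    have h4 : h (c r) = (y : ℝ) - 1 / 2 := by
      rw [← hr]
      exact hs.2 y hy1.le hy2.le
    have h5 := congrArg Complex.im h4
    simp [c] at h5
    rcases h5 with h5 | h5
    · exact hr₀ h5
    · exact h1.ne' h5
  refine ⟨connectedComponentIn (Set.range G.emb)ᶜ (c (δ / 2)),
    ⟨_, hoff _ ⟨by linarith, by linarith⟩, rfl⟩, h, hs, ?_⟩
  have hsub : c '' Set.Ioo 0 δ ⊆ connectedComponentIn (Set.range G.emb)ᶜ (c (δ / 2)) := by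
    refine IsPreconnected.subset_connectedComponentIn ?_ ⟨δ / 2, ⟨by linarith, by linarith⟩, rfl⟩ ?_
    · exact isPreconnected_Ioo.image _ hc.continuousOn
    · rintro _ ⟨r, hr, rfl⟩
      exact hoff r hr
  filter_upwards [Ioo_mem_nhdsGT hδ] with r hr
  exact hsub ⟨r, hr, rfl⟩

namespace AnchoredGraph

variable {G : AnchoredGraph.{u}}

namespace IsAtomic

/-- The unique interior face of an atomic graph. -/
noncomputable def face (hG : G.IsAtomic) : G.InteriorFace := hG.choose

theorem exists_paths (hG : G.IsAtomic) :
    ∃ (P : Path G.ext.s (G.bd hG.face).s) (P' : Path (G.bd hG.face).t G.ext.t),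
      G.ext.dom = (P.comp (G.bd hG.face).dom).comp P' ∧
      G.ext.codom = (P.comp (G.bd hG.face).codom).comp P' := by
  obtain ⟨huniq, hdisj⟩ := hG.choose_spec
  change ∀ F', F' = hG.face at huniq
  change List.Disjoint (Graph.edges (G.bd hG.face).dom) (Graph.edges (G.bd hG.face).codom) at hdisj
  generalize hG.face = F at *
  have right : ∀ {e h}, G.Straightens h e →
      e ∈ Graph.edges (G.bd F).dom ∨ e ∈ Graph.edges G.ext.codom := by
    intro e h hs
    obtain ⟨F', hF', hside⟩ := G.exists_face_onSide hs (c₀ := -1) (by norm_num)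
    by_cases hb : Bornology.IsBounded F'
    · have := huniq ⟨F', hF', hb⟩
      subst this
      exact .inl ((G.mem_bd_dom _ _).2 hside)
    · exact .inr ((G.mem_ext_codom F' ⟨hF', hb⟩ e).2 hside)
  have left : ∀ {e h}, G.Straightens h e →
      e ∈ Graph.edges (G.bd F).codom ∨ e ∈ Graph.edges G.ext.dom := by
    intro e h hs
    obtain ⟨F', hF', hside⟩ := G.exists_face_onSide hs (c₀ := 1) (by norm_num)
    by_cases hb : Bornology.IsBounded F'
    · have := huniq ⟨F', hF', hb⟩
      subst this
      exact .inl ((G.mem_bd_codom _ _).2 hside)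
    · exact .inr ((G.mem_ext_dom F' ⟨hF', hb⟩ e).2 hside)
  have hdom : ∀ e ∈ Graph.edges (G.bd F).dom, e ∈ Graph.edges G.ext.dom := by
    intro e he
    obtain ⟨h, hs, -⟩ := (G.mem_bd_dom _ _).1 he
    exact (left hs).resolve_left (fun h' => hdisj he h')
  have hcodom : ∀ e ∈ Graph.edges (G.bd F).codom, e ∈ Graph.edges G.ext.codom := by
    intro e he
    obtain ⟨h, hs, -⟩ := (G.mem_bd_codom _ _).1 he
    exact (right hs).resolve_left (fun h' => hdisj h' he)
  have hlen : (G.bd F).dom.length ≠ 0 := fun h0 => (G.bd_proper F).ne (Path.eq_of_length_zero _ h0)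
  have hlen' : (G.bd F).codom.length ≠ 0 :=
    fun h0 => (G.bd_proper F).ne (Path.eq_of_length_zero _ h0)
  have hext : ∃ F', G.IsExteriorFace F' := by
    obtain ⟨e, he⟩ := Graph.exists_mem_edges _ hlen
    obtain ⟨h, hs, -⟩ := (G.mem_bd_dom _ _).1 he
    obtain ⟨F', hF', hside⟩ := G.exists_face_onSide hs (c₀ := 1) (by norm_num)
    refine ⟨F', hF', fun hb => ?_⟩
    have := huniq ⟨F', hF', hb⟩
    subst this
    exact hdisj he ((G.mem_bd_codom _ _).2 hside)
  have hout : ∀ e ∈ Graph.edges G.ext.dom, e ∉ Graph.edges (G.bd F).dom →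
      e ∈ Graph.edges G.ext.codom := by
    intro e he hne
    obtain ⟨F', hF'⟩ := hext
    obtain ⟨h, hs, -⟩ := (G.mem_ext_dom F' hF' e).1 he
    exact (right hs).resolve_left hne
  have nd := G.ext_proper.dom_nodup
  have nc := G.ext_proper.codom_nodup
  obtain ⟨P, P', hP⟩ := Graph.contiguous nd _ hlen hdom
  obtain ⟨Q, Q', hQ⟩ := Graph.contiguous nc _ hlen' hcodom
  have hnd := Graph.edges_nodup nd
  rw [hP, Graph.edges_comp, Graph.edges_comp] at hnd
  have hmem : ∀ e, e ∈ Graph.edges P ∨ e ∈ Graph.edges P' → e ∈ Graph.edges G.ext.codom := by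
    intro e he
    refine hout e ?_ ?_
    · rw [hP, Graph.edges_comp, Graph.edges_comp]
      simp only [List.mem_append]
      tauto
    · intro he'
      rw [List.nodup_append', List.nodup_append'] at hnd
      rcases he with he | he
      · exact hnd.1.2.2 he he'
      · exact hnd.2.2 (List.mem_append_right _ he') he
  obtain ⟨R, hR⟩ := Graph.exists_prefix nc P (fun e he => hmem e (.inl he))
  obtain ⟨R', hR'⟩ := Graph.exists_suffix nc P' (fun e he => hmem e (.inr he))
  have h1 : P.comp R = Q.comp ((G.bd F).codom.comp Q') := by
    rw [← hR, hQ, Path.comp_assoc]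
  obtain ⟨rfl, -⟩ := Graph.split_unique h1 (hR ▸ nc)
  obtain ⟨-, rfl⟩ := Graph.split_unique (hR'.symm.trans hQ) (hR' ▸ nc)
  exact ⟨P, P', hP, hQ⟩

end IsAtomic
end AnchoredGraph

/-! ### Vertical composites and pasting scheme presentations -/

/-- An identification of a plane graph with a part of another plane graph: an injection of
vertices and edges that preserves incidence and is induced by an orientation preserving
homeomorphism of the plane. -/
structure PlaneInclusion (G K : PlaneGraph.{u}) where
  onV : G.V → K.V
  onE : G.E → K.E
  tail_onE : ∀ e, K.tail (onE e) = onV (G.tail e)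
  head_onE : ∀ e, K.head (onE e) = onV (G.head e)
  homeo : ℂ ≃ₜ ℂ
  orientationPreserving : OrientationPreserving homeo
  homeo_point : ∀ a, homeo (G.point a) = K.point (onV a)
  homeo_curve : ∀ e, homeo '' Set.range (G.curve e) = Set.range (K.curve (onE e))

/-- The underlying morphism of directed graphs. -/
def PlaneInclusion.functor {G K : PlaneGraph.{u}} (i : PlaneInclusion G K) : G.V ⥤q K.V where
  obj := i.onV
  map e := ⟨i.onE e.1, (i.tail_onE _).trans (congrArg _ e.2.1),
    (i.head_onE _).trans (congrArg _ e.2.2)⟩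

/-- An inclusion of plane graphs that takes interior faces to interior faces, with the same
anchoring. -/
structure AnchoredInclusion (G K : AnchoredGraph.{u}) extends
    PlaneInclusion G.toPlaneGraph K.toPlaneGraph where
  isInteriorFace : ∀ F : G.InteriorFace, K.IsInteriorFace (homeo '' F.1)
  bd_eq : ∀ F : G.InteriorFace,
    K.bd ⟨homeo '' F.1, isInteriorFace F⟩ = (G.bd F).map toPlaneInclusion.functor

/-- The map on interior faces. -/
def AnchoredInclusion.onFace {G K : AnchoredGraph.{u}} (i : AnchoredInclusion G K)
    (F : G.InteriorFace) : K.InteriorFace :=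
  ⟨i.homeo '' F.1, i.isInteriorFace F⟩

/-- An identification of the anchored graph `K` with the vertical composite `HG`: `K` is obtained
from `G` and `H` by identifying the codomain of `G` with the domain of `H` (both become the path
`mid`), and nothing else; its interior faces are those of `G` and those of `H`, its exterior face
is the intersection of those of `G` and `H`, its domain is that of `G` and its codomain is
that of `H`. -/
structure VerticalComposite (H G K : AnchoredGraph.{u}) where
  inl : AnchoredInclusion G K
  inr : AnchoredInclusion H K
  mid : Path K.ext.s K.ext.t
  ext_inl : G.ext.map inl.functor = ⟨K.ext.s, K.ext.t, K.ext.dom, mid⟩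
  ext_inr : H.ext.map inr.functor = ⟨K.ext.s, K.ext.t, mid, K.ext.codom⟩
  cover_V : ∀ a : K.V, (∃ b, inl.onV b = a) ∨ (∃ c, inr.onV c = a)
  cover_E : ∀ e : K.E, (∃ f, inl.onE f = e) ∨ (∃ g, inr.onE g = e)
  inter_V : ∀ b c, inl.onV b = inr.onV c →
    b ∈ G.ext.codom.vertices ∧ c ∈ H.ext.dom.vertices
  inter_E : ∀ f g, inl.onE f = inr.onE g →
    f ∈ Graph.edges G.ext.codom ∧ g ∈ Graph.edges H.ext.dom
  cover_face : ∀ F : K.InteriorFace, (∃ F', inl.onFace F' = F) ∨ (∃ F', inr.onFace F' = F)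
  inter_face : ∀ F F', inl.onFace F ≠ inr.onFace F'
  exterior : ∀ F F', G.IsExteriorFace F → H.IsExteriorFace F' →
    K.IsExteriorFace (inl.homeo '' F ∩ inr.homeo '' F')

/-- A pasting scheme presentation `K = Gₙ ⋯ G₁` with `n ≥ 1` atomic graphs: either `K` itself
is atomic, or `K = H G₁` with `G₁` atomic and a presentation `H = Gₙ ⋯ G₂`. -/
inductive Presentation : AnchoredGraph.{u} → Type (u + 1)
  | atomic {K : AnchoredGraph.{u}} (hK : K.IsAtomic) : Presentation K
  | comp {H G K : AnchoredGraph.{u}} (c : VerticalComposite H G K) (hG : G.IsAtomic)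
      (p : Presentation H) : Presentation K

/-! ### Diagrams in a 2-category and their composites -/

section Diagrams

variable {B : Type v₁} [Bicategory.{v₃, v₂} B]

/-- The horizontal composite of the 1-cells assigned to the edges of a directed path. -/
def compPath {G : Graph.{u}} (φ : G.V ⥤q B) {a : G.V} :
    ∀ {b : G.V}, Path a b → (φ.obj a ⟶ φ.obj b)
  | _, .nil => 𝟙 _
  | _, .cons p e => compPath φ p ≫ φ.map e

theorem compPath_mapPath {G K : Graph.{u}} (f : G.V ⥤q K.V) (φ : K.V ⥤q B) {a b : G.V}
    (p : Path a b) : compPath φ (f.mapPath p) = compPath (f ⋙q φ) p := by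
  induction p with
  | nil => rfl
  | cons p e ih => simp only [Prefunctor.mapPath_cons, compPath, ih]; rfl

theorem compPath_comp [Bicategory.Strict B] {G : Graph.{u}} (φ : G.V ⥤q B) {a b c : G.V}
    (p : Path a b) (q : Path b c) :
    compPath φ (p.comp q) = compPath φ p ≫ compPath φ q := by
  induction q with
  | nil => exact (Bicategory.Strict.comp_id _).symm
  | cons q e ih => simp only [Path.comp_cons, compPath, ih, Bicategory.Strict.assoc]

/-- The 2-cells from the composite of the domain to the composite of the codomain. -/
def Graph.PathPair.Cell {G : Graph.{u}} (X : G.PathPair) (φ : G.V ⥤q B) : Type v₃ :=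
  compPath φ X.dom ⟶ compPath φ X.codom

theorem Graph.PathPair.cell_map {G K : Graph.{u}} (f : G.V ⥤q K.V) (X : G.PathPair)
    (φ : K.V ⥤q B) : (X.map f).Cell φ = X.Cell (f ⋙q φ) := by
  simp only [Graph.PathPair.Cell, Graph.PathPair.map, compPath_mapPath]
  rfl

variable (B) in
/-- A `G`-diagram: an object for every vertex, a 1-cell for every edge, and a 2-cell for every
interior face. -/
structure Diagram (G : AnchoredGraph.{u}) where
  skel : G.V ⥤q B
  cell : ∀ F : G.InteriorFace, (G.bd F).Cell skel

namespace Diagram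

/-- The restriction of a diagram along an inclusion of anchored graphs. -/
def restrict {G K : AnchoredGraph.{u}} (φ : Diagram B K) (i : AnchoredInclusion G K) :
    Diagram B G where
  skel := i.functor ⋙q φ.skel
  cell F := cast ((congrArg (fun X => X.Cell φ.skel) (i.bd_eq F)).trans
    (Graph.PathPair.cell_map _ _ _)) (φ.cell (i.onFace F))

variable [Bicategory.Strict B]

/-- The composite of a diagram on an atomic graph: the 2-cell of the interior face, whiskered with
the 1-cells of the directed path from the source of the graph to the source of the face and of the
directed path from the sink of the face to the sink of the graph. -/
noncomputable def constituent {G : AnchoredGraph.{u}} (φ : Diagram B G) (hG : G.IsAtomic) :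
    G.ext.Cell φ.skel :=
  let P := hG.exists_paths.choose
  let P' := hG.exists_paths.choose_spec.choose
  have h := hG.exists_paths.choose_spec.choose_spec
  eqToHom (by rw [h.1, compPath_comp, compPath_comp]) ≫
    (compPath φ.skel P ◁ φ.cell hG.face) ▷ compPath φ.skel P' ≫
    eqToHom (by rw [h.2, compPath_comp, compPath_comp])

/-- The vertical composite, in `HG`, of a 2-cell for `G` followed by a 2-cell for `H`. -/
def vcomp {H G K : AnchoredGraph.{u}} (c : VerticalComposite H G K) (φ : Diagram B K)
    (α : G.ext.Cell (φ.restrict c.inl).skel) (β : H.ext.Cell (φ.restrict c.inr).skel) :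
    K.ext.Cell φ.skel :=
  let α' : compPath φ.skel K.ext.dom ⟶ compPath φ.skel c.mid :=
    cast ((Graph.PathPair.cell_map c.inl.functor G.ext φ.skel).symm.trans
      (congrArg (fun X => X.Cell φ.skel) c.ext_inl)) α
  let β' : compPath φ.skel c.mid ⟶ compPath φ.skel K.ext.codom :=
    cast ((Graph.PathPair.cell_map c.inr.functor H.ext φ.skel).symm.trans
      (congrArg (fun X => X.Cell φ.skel) c.ext_inr)) β
  α' ≫ β'

/-- The composite of a diagram with respect to a pasting scheme presentation: the vertical
composite of its constituent 2-cells. -/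
noncomputable def composite : ∀ {K : AnchoredGraph.{u}}, Presentation K → ∀ φ : Diagram B K,
    K.ext.Cell φ.skel
  | _, .atomic hK, φ => φ.constituent hK
  | _, .comp c hG p, φ =>
      vcomp c φ ((φ.restrict c.inl).constituent hG) (composite p (φ.restrict c.inr))

end Diagram

end Diagrams

end Pasting

/-!
A presentation of `G` is a sequence of elementary moves on directed paths, from `dom_G` to
`codom_G`: a path `P dom_F P'` is replaced by `P codom_F P'`, and every interior face `F` is used
exactly once (`IsPasting`, `Diagram.exists_isPasting_composite`). The composite of a diagram is the
vertical composite of the whiskered 2-cells of these moves, so two presentations have to be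
compared that use the same faces in different orders.

The existence of one presentation forces strong disjointness: an edge that a move removes never
comes back. Hence distinct faces have edge-disjoint domains and edge-disjoint codomains, and no
codomain of a face meets `dom_G` (`Presentation.isEdgeDisjoint`,
`Presentation.disjoint_codom`). This uses only that the two parts of a vertical composite
meet in their common boundary path, and that the domain and the codomain of the face of an atomic
graph are edge-disjoint.

Let `F` be the first face of the second presentation, so that `dom_G = P dom_F P'`. In the first
presentation, each move made before that of `F` replaces a subpath that is edge-disjoint from
`dom_F`, so it takes place entirely before or entirely after `dom_F` in the path, and by the
exchange law the move of `F` can be made first (`IsPasting.exists_cons`). Because paths have no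
repeated edges, `dom_F` occurs only once, so both sequences now begin with the same whiskered
2-cell, and induction on the number of faces finishes the proof (`IsPasting.unique`).

In a strict bicategory, 1-cells that are equal but not definitionally so are compared by `eqToHom`.
-/

namespace Pasting

/-! ### Factorizations of directed paths -/

namespace Graph

variable {G : Graph.{u}}

/-- The shorter one of two initial segments of a path is an initial segment of the longer one. -/
theorem exists_comp_eq_of_length_le {a b b' c : G.V} {A : Path a b} {X : Path b c}
    {A' : Path a b'} {X' : Path b' c} (h : A.comp X = A'.comp X') (hl : A.length ≤ A'.length) :
    ∃ C : Path b b', A' = A.comp C ∧ X = C.comp X' := by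
  induction X' with
  | nil => exact ⟨X, h.symm, rfl⟩
  | cons Y e ih =>
    cases X with
    | nil =>
      have := congrArg Path.length h
      simp at this
      omega
    | cons X f =>
      simp only [Path.comp_cons] at h
      obtain rfl := Path.obj_eq_of_cons_eq_cons h
      obtain rfl := eq_of_heq (Path.hom_heq_of_cons_eq_cons h)
      obtain ⟨C, h1, rfl⟩ := ih (eq_of_heq (Path.heq_of_cons_eq_cons h))
      exact ⟨C, h1, rfl⟩

theorem not_disjoint_of_comp_eq {a b b' c : G.V} {A : Path a b} {X : Path b c}
    {A' : Path a b'} {X' : Path b' c} (h : A.comp X = A'.comp X') (hA : A.length ≠ 0)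
    (hA' : A'.length ≠ 0) : ¬ List.Disjoint (edges A) (edges A') := by
  intro hd
  rcases le_total A.length A'.length with hl | hl
  · obtain ⟨C, rfl, -⟩ := exists_comp_eq_of_length_le h hl
    obtain ⟨e, he⟩ := exists_mem_edges A hA
    exact hd he (by simp [edges_comp, he])
  · obtain ⟨C, rfl, -⟩ := exists_comp_eq_of_length_le h.symm hl
    obtain ⟨e, he⟩ := exists_mem_edges A' hA'
    exact hd (by simp [edges_comp, he]) he

theorem exists_comp_eq_of_disjoint_of_length_le {a b c b' c' t : G.V} {P : Path a b}
    {d : Path b c} {P' : Path c t} {A : Path a b'} {d' : Path b' c'} {A' : Path c' t}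
    (h : (P.comp d).comp P' = (A.comp d').comp A') (hd : d.length ≠ 0)
    (hdisj : List.Disjoint (edges d) (edges d')) (hl : A.length ≤ P.length) :
    ∃ C : Path c' b, P = (A.comp d').comp C ∧ A' = (C.comp d).comp P' := by
  rw [Path.comp_assoc] at h
  by_cases hl' : (A.comp d').length ≤ P.length
  · obtain ⟨C, h1, h2⟩ := exists_comp_eq_of_length_le h.symm hl'
    exact ⟨C, h1, by rw [h2, Path.comp_assoc]⟩
  · exfalso
    rw [Path.comp_assoc] at h
    obtain ⟨C, rfl, h2⟩ := exists_comp_eq_of_length_le h.symm hl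
    obtain ⟨D, rfl, h3⟩ := exists_comp_eq_of_length_le h2.symm (by simp at hl'; omega)
    refine not_disjoint_of_comp_eq h3 hd (by simp at hl'; omega) ?_
    rw [edges_comp, List.disjoint_append_right] at hdisj
    exact hdisj.2

/-- Two edge-disjoint nonempty subpaths of a path follow each other, in one of the two orders. -/
theorem exists_comp_eq_of_disjoint {a b c b' c' t : G.V} {P : Path a b}
    {d : Path b c} {P' : Path c t} {A : Path a b'} {d' : Path b' c'} {A' : Path c' t}
    (h : (P.comp d).comp P' = (A.comp d').comp A') (hd : d.length ≠ 0) (hd' : d'.length ≠ 0)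
    (hdisj : List.Disjoint (edges d) (edges d')) :
    (∃ C : Path c' b, P = (A.comp d').comp C ∧ A' = (C.comp d).comp P') ∨
      ∃ C : Path c b', A = (P.comp d).comp C ∧ P' = (C.comp d').comp A' := by
  rcases le_total A.length P.length with hl | hl
  · exact .inl (exists_comp_eq_of_disjoint_of_length_le h hd hdisj hl)
  · exact .inr (exists_comp_eq_of_disjoint_of_length_le h.symm hd' hdisj.symm hl)

/-- A nonempty path occurs at most once in a path without repeated edges. -/
theorem eq_of_comp_eq {a b c t : G.V} {P A : Path a b} {d : Path b c} {P' A' : Path c t}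
    (h : (P.comp d).comp P' = (A.comp d).comp A') (hd : d.length ≠ 0)
    (hn : (edges ((P.comp d).comp P')).Nodup) : P = A ∧ P' = A' := by
  have key : ∀ {P A : Path a b} {P' A' : Path c t}, (P.comp d).comp P' = (A.comp d).comp A' →
      (edges ((P.comp d).comp P')).Nodup → A.length ≤ P.length → P = A := by
    intro P A P' A' h hn hl
    rw [Path.comp_assoc, Path.comp_assoc] at h
    obtain ⟨C, rfl, h2⟩ := exists_comp_eq_of_length_le h.symm hl
    by_cases hC : C.length = 0
    · rw [Path.eq_nil_of_length_zero C hC, Path.comp_nil]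
    · refine absurd ?_ (not_disjoint_of_comp_eq h2 hd hC)
      simp only [edges_comp, List.nodup_append', List.disjoint_append_left] at hn
      exact hn.1.2.2.2.symm
  have hPA : P = A := by
    rcases le_total A.length P.length with hl | hl
    · exact key h hn hl
    · exact (key h.symm (h ▸ hn) hl).symm
  exact ⟨hPA, ((Path.comp_inj' (by simp [hPA])).1 h).2⟩

end Graph

/-! ### Whiskering with composites of paths -/

section Whiskering

variable {B : Type v₁} [Bicategory.{v₃, v₂} B] [Bicategory.Strict B]

theorem whiskerRight_comp_eq {x y z w : B} {f f' : x ⟶ y} (α : f ⟶ f') (g : y ⟶ z) (h : z ⟶ w) :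
    α ▷ (g ≫ h) = eqToHom (Bicategory.Strict.assoc _ _ _).symm ≫ (α ▷ g) ▷ h ≫
      eqToHom (Bicategory.Strict.assoc _ _ _) := by
  simp [Bicategory.Strict.associator_eqToIso]

theorem comp_whiskerLeft_eq {x y z w : B} (g : x ⟶ y) (h : y ⟶ z) {f f' : z ⟶ w} (α : f ⟶ f') :
    (g ≫ h) ◁ α = eqToHom (Bicategory.Strict.assoc _ _ _) ≫ g ◁ h ◁ α ≫
      eqToHom (Bicategory.Strict.assoc _ _ _).symm := by
  simp [Bicategory.Strict.associator_eqToIso]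

/-- The exchange law for two 2-cells `α` and `β` that are whiskered with 1-cells before, between and
after them. -/
theorem whiskering_exchange {x₀ x₁ x₂ x₃ x₄ x₅ : B} (f : x₀ ⟶ x₁) {d c : x₁ ⟶ x₂} (m : x₂ ⟶ x₃)
    {d' c' : x₃ ⟶ x₄} (g : x₄ ⟶ x₅) (α : d ⟶ c) (β : d' ⟶ c') :
    (f ◁ α) ▷ ((m ≫ d') ≫ g) ≫ eqToHom (by simp only [Bicategory.Strict.assoc]) ≫
      (((f ≫ c) ≫ m) ◁ β) ▷ g =
    eqToHom (by simp only [Bicategory.Strict.assoc]) ≫ (((f ≫ d) ≫ m) ◁ β) ▷ g ≫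
      eqToHom (by simp only [Bicategory.Strict.assoc]) ≫ (f ◁ α) ▷ ((m ≫ c') ≫ g) ≫
      eqToHom (by simp only [Bicategory.Strict.assoc]) := by
  have h := congrArg (· ▷ g) (whisker_exchange (f ◁ α) (m ◁ β))
  simp only [comp_whiskerRight] at h
  have h' := eq_whisker h.symm (eqToHom (show ((f ≫ c) ≫ m ≫ c') ≫ g = (((f ≫ c) ≫ m) ≫ c') ≫ g by
    simp only [Bicategory.Strict.assoc]))
  simp only [Category.assoc] at h'
  rw [whiskerRight_comp_eq _ (m ≫ d') g, comp_whiskerLeft_eq (f ≫ c) m,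
    comp_whiskerLeft_eq (f ≫ d) m, whiskerRight_comp_eq _ (m ≫ c') g]
  simp only [comp_whiskerRight, eqToHom_whiskerRight, Category.assoc, eqToHom_trans,
    eqToHom_trans_assoc, eqToHom_refl, Category.id_comp, h']

theorem whiskerRight_congr {x y z : B} {f f' : x ⟶ y} (α : f ⟶ f') {g g' : y ⟶ z} (h : g = g') :
    α ▷ g = eqToHom (by rw [h]) ≫ α ▷ g' ≫ eqToHom (by rw [h]) := by
  subst h; simp

theorem whiskerLeft_congr {x y z : B} {f f' : y ⟶ z} (α : f ⟶ f') {g g' : x ⟶ y} (h : g = g') :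
    g ◁ α = eqToHom (by rw [h]) ≫ g' ◁ α ≫ eqToHom (by rw [h]) := by
  subst h; simp

variable {G : Graph.{u}} (φ : G.V ⥤q B)

/-- The 2-cell `α` whiskered with the composites of the directed paths `P` and `P'`. -/
def whisker {a b c d : G.V} (P : Path a b) (P' : Path c d) {p q : Path b c}
    (α : compPath φ p ⟶ compPath φ q) :
    compPath φ ((P.comp p).comp P') ⟶ compPath φ ((P.comp q).comp P') :=
  eqToHom (by rw [compPath_comp, compPath_comp]) ≫
    (compPath φ P ◁ α) ▷ compPath φ P' ≫ eqToHom (by rw [compPath_comp, compPath_comp])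

/-- 2-cells on two subpaths of a path that follow each other can be pasted in either order. -/
theorem whisker_comp_whisker {x₀ x₁ x₂ x₃ x₄ x₅ : G.V} (A : Path x₀ x₁) {d c : Path x₁ x₂}
    (C : Path x₂ x₃) {d' c' : Path x₃ x₄} (E : Path x₄ x₅) (α : compPath φ d ⟶ compPath φ c)
    (β : compPath φ d' ⟶ compPath φ c') :
    whisker φ A ((C.comp d').comp E) α ≫ eqToHom (by simp only [Path.comp_assoc]) ≫
      whisker φ ((A.comp c).comp C) E β =
    eqToHom (by simp only [Path.comp_assoc]) ≫ whisker φ ((A.comp d).comp C) E β ≫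
      eqToHom (by simp only [Path.comp_assoc]) ≫ whisker φ A ((C.comp c').comp E) α ≫
      eqToHom (by simp only [Path.comp_assoc]) := by
  have hR : ∀ {a b c d : G.V} (p : Path a b) (q : Path b c) (r : Path c d),
      compPath φ ((p.comp q).comp r) = (compPath φ p ≫ compPath φ q) ≫ compPath φ r := by
    intros; rw [compPath_comp, compPath_comp]
  unfold whisker
  rw [whiskerRight_congr _ (hR C d' E), whiskerRight_congr _ (hR C c' E),
    whiskerLeft_congr _ (hR A c C), whiskerLeft_congr _ (hR A d C)]
  have := whiskering_exchange (compPath φ A) (compPath φ C) (compPath φ E) α β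
  have h' := eq_whisker this (eqToHom (show _ = compPath φ ((((A.comp c).comp C).comp c').comp E) by
    simp only [compPath_comp, Bicategory.Strict.assoc]))
  simp only [Category.assoc, eqToHom_trans] at h'
  simp only [comp_whiskerRight, eqToHom_whiskerRight, Category.assoc, eqToHom_trans,
    eqToHom_trans_assoc, h']

theorem whisker_mapPath {K : Graph.{u}} (f : G.V ⥤q K.V) (ψ : K.V ⥤q B) {a b c d : G.V}
    (P : Path a b) (P' : Path c d) {p q : Path b c}
    (α : compPath (f ⋙q ψ) p ⟶ compPath (f ⋙q ψ) q) :
    whisker ψ (f.mapPath P) (f.mapPath P') (p := f.mapPath p) (q := f.mapPath q)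
      (eqToHom (compPath_mapPath f ψ p) ≫ α ≫ eqToHom (compPath_mapPath f ψ q).symm) =
    eqToHom (by rw [← Prefunctor.mapPath_comp, ← Prefunctor.mapPath_comp, compPath_mapPath]) ≫
      whisker (f ⋙q ψ) P P' α ≫
      eqToHom (by rw [← Prefunctor.mapPath_comp, ← Prefunctor.mapPath_comp, compPath_mapPath]) := by
  -- stated for arbitrary 1-cells, so that the equalities between composites can be substituted
  have hc : ∀ {x y z w : B} {p p' : x ⟶ y} {d d' c c' : y ⟶ z} {g g' : z ⟶ w} {k k' l l' : x ⟶ w}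
      (_ : p = p') (_ : g = g') (hd : d' = d) (hc : c = c') (α : d ⟶ c) (e₁ : k = (p' ≫ d') ≫ g')
      (e₂ : (p' ≫ c') ≫ g' = l) (e₃ : k = k') (e₄ : k' = (p ≫ d) ≫ g) (e₅ : (p ≫ c) ≫ g = l')
      (e₆ : l' = l),
      eqToHom e₁ ≫ (p' ◁ (eqToHom hd ≫ α ≫ eqToHom hc)) ▷ g' ≫ eqToHom e₂ =
        eqToHom e₃ ≫ (eqToHom e₄ ≫ (p ◁ α) ▷ g ≫ eqToHom e₅) ≫ eqToHom e₆ := by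
    rintro x y z w p _ d _ c _ g _ k k' l l' rfl rfl rfl rfl α e₁ rfl rfl e₄ e₅ e₆
    simp
  exact hc (compPath_mapPath f ψ P).symm (compPath_mapPath f ψ P').symm _ _ _ _ _ _ _ _ _

end Whiskering

/-! ### Sequences of whiskered cells -/

section Sequences

variable {B : Type v₁} [Bicategory.{v₃, v₂} B] [Bicategory.Strict B] {G : Graph.{u}} {ι : Type*}
  (φ : G.V ⥤q B) (bd : ι → G.PathPair) (cell : ∀ i, (bd i).Cell φ) {s t : G.V}

/-- `IsPasting φ bd cell L Q Q' α`: the 2-cell `α` is the vertical composite of a sequence of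
whiskered cells, which leads from the directed path `Q` to the directed path `Q'`. The entries of
`L` are, in order, the indices of the cells; the step for `i` replaces a subpath `(bd i).dom` by
`(bd i).codom`. -/
inductive IsPasting : List ι → ∀ Q Q' : Path s t, (compPath φ Q ⟶ compPath φ Q') → Prop
  | nil (Q : Path s t) : IsPasting [] Q Q (𝟙 _)
  | cons (i : ι) (P : Path s (bd i).s) (P' : Path (bd i).t t) {L : List ι} {Q' : Path s t}
      {α : compPath φ ((P.comp (bd i).codom).comp P') ⟶ compPath φ Q'}
      (h : IsPasting L ((P.comp (bd i).codom).comp P') Q' α) :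
      IsPasting (i :: L) ((P.comp (bd i).dom).comp P') Q' (whisker φ P P' (cell i) ≫ α)

theorem heq_eqToHom_comp_comp_eqToHom {C : Type*} [Category* C] {X X' Y Y' : C} (f : X ⟶ Y)
    (h : X' = X) (h' : Y = Y') : HEq f (eqToHom h ≫ f ≫ eqToHom h') := by
  subst h h'
  simp

namespace IsPasting

variable {φ bd cell}

theorem congr_left {L : List ι} {Q₁ Q Q' : Path s t} {α : compPath φ Q ⟶ compPath φ Q'}
    (h : IsPasting φ bd cell L Q Q' α) (hQ : Q₁ = Q) :
    IsPasting φ bd cell L Q₁ Q' (eqToHom (by rw [hQ]) ≫ α) := by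
  subst hQ
  simpa using h

theorem single (i : ι) (P : Path s (bd i).s) (P' : Path (bd i).t t) :
    IsPasting φ bd cell [i] ((P.comp (bd i).dom).comp P') ((P.comp (bd i).codom).comp P')
      (whisker φ P P' (cell i)) := by
  simpa using cons (cell := cell) i P P' (nil _)

theorem append {L L' : List ι} {Q Q' Q'' : Path s t} {α : compPath φ Q ⟶ compPath φ Q'}
    {β : compPath φ Q' ⟶ compPath φ Q''} (h : IsPasting φ bd cell L Q Q' α)
    (h' : IsPasting φ bd cell L' Q' Q'' β) : IsPasting φ bd cell (L ++ L') Q Q'' (α ≫ β) := by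
  induction h with
  | nil Q => simpa using h'
  | cons i P P' h ih =>
    rw [Category.assoc]
    exact cons i P P' (ih h')

end IsPasting

/-- No edge is in the domains of two cells or in the codomains of two cells. Moreover, the codomain
of a cell has no repeated edges, and its source and sink are distinct, so that neither its domain
nor its codomain is empty. -/
structure IsEdgeDisjoint : Prop where
  ne : ∀ i, (bd i).s ≠ (bd i).t
  codom_nodup : ∀ i, (Graph.edges (bd i).codom).Nodup
  dom_disjoint : ∀ i j, i ≠ j → List.Disjoint (Graph.edges (bd i).dom) (Graph.edges (bd j).dom)
  codom_disjoint : ∀ i j, i ≠ j →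
    List.Disjoint (Graph.edges (bd i).codom) (Graph.edges (bd j).codom)

/-- The cells of `L` can be pasted to `Q` without using an edge twice: the path `Q` has no
repeated edges, the cells of `L` are distinct, and no edge of `Q` is in one of their codomains. -/
structure IsFresh (L : List ι) (Q : Path s t) : Prop where
  edges_nodup : (Graph.edges Q).Nodup
  nodup : L.Nodup
  disjoint : ∀ i ∈ L, List.Disjoint (Graph.edges (bd i).codom) (Graph.edges Q)

variable {bd}

theorem IsEdgeDisjoint.dom_length_ne_zero (hbd : IsEdgeDisjoint bd) (i : ι) :
    (bd i).dom.length ≠ 0 :=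
  fun h => hbd.ne i (Path.eq_of_length_zero _ h)

theorem IsFresh.perm {L L' : List ι} {Q : Path s t} (h : IsFresh bd L Q) (hL : L.Perm L') :
    IsFresh bd L' Q :=
  ⟨h.1, hL.nodup_iff.1 h.2, fun i hi => h.3 i (hL.mem_iff.2 hi)⟩

theorem IsFresh.step (hbd : IsEdgeDisjoint bd) {i : ι} {L : List ι} {P : Path s (bd i).s}
    {P' : Path (bd i).t t} (h : IsFresh bd (i :: L) ((P.comp (bd i).dom).comp P')) :
    IsFresh bd L ((P.comp (bd i).codom).comp P') := by
  obtain ⟨h1, h2, h3⟩ := h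
  have h4 := h3 i (by simp)
  rw [List.nodup_cons] at h2
  refine ⟨?_, h2.2, fun j hj => ?_⟩
  · simp only [Graph.edges_comp, List.nodup_append', List.disjoint_append_left,
      List.disjoint_append_right] at h1 h4 ⊢
    exact ⟨⟨h1.1.1, hbd.codom_nodup i, h4.1.1.symm⟩, h1.2.1, h1.2.2.1, h4.2⟩
  · have h5 := h3 j (by simp [hj])
    have h6 := hbd.codom_disjoint j i (by rintro rfl; exact h2.1 hj)
    simp only [Graph.edges_comp, List.disjoint_append_right] at h5 ⊢
    exact ⟨⟨h5.1.1, h6⟩, h5.2⟩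

namespace IsPasting

variable {φ cell}

/-- A cell of a pasting whose domain is a subpath of the initial path can be pasted first: each of
the cells pasted before it has an edge-disjoint domain, and the two can be exchanged. -/
theorem exists_cons (hbd : IsEdgeDisjoint bd) {L : List ι} {Q Q' : Path s t}
    {α : compPath φ Q ⟶ compPath φ Q'} (h : IsPasting φ bd cell L Q Q' α) (hL : IsFresh bd L Q)
    {i : ι} (hi : i ∈ L) {P : Path s (bd i).s} {P' : Path (bd i).t t}
    (hQ : Q = (P.comp (bd i).dom).comp P') :
    ∃ L' β, L.Perm (i :: L') ∧ IsPasting φ bd cell L' ((P.comp (bd i).codom).comp P') Q' β ∧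
      α = eqToHom (by rw [hQ]) ≫ whisker φ P P' (cell i) ≫ β := by
  induction h generalizing P P' with
  | nil Q => simp at hi
  | @cons j A A' L Q' γ h ih =>
    by_cases hij : i = j
    · subst hij
      obtain ⟨rfl, rfl⟩ := Graph.eq_of_comp_eq hQ (hbd.dom_length_ne_zero i) hL.edges_nodup
      exact ⟨L, γ, .rfl, h, by simp⟩
    have hiL : i ∈ L := by simpa [hij] using hi
    have hfr := hL.step hbd
    rcases Graph.exists_comp_eq_of_disjoint hQ (hbd.dom_length_ne_zero j)
      (hbd.dom_length_ne_zero i) (hbd.dom_disjoint j i (Ne.symm hij)) with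
      ⟨C, rfl, rfl⟩ | ⟨C, rfl, rfl⟩
    -- the cell `j` acts after the subpath `(bd i).dom`
    · obtain ⟨L', β, hp, h', rfl⟩ := ih hfr hiL (P := P) (P' := (C.comp (bd j).codom).comp A')
        (by simp only [Path.comp_assoc])
      refine ⟨j :: L', _, (hp.cons j).trans (.swap _ _ _), (cons j ((P.comp (bd i).codom).comp C) A'
        (h'.congr_left (by simp only [Path.comp_assoc]))).congr_left
          (by simp only [Path.comp_assoc]), ?_⟩
      have := whisker_comp_whisker φ P C A' (cell i) (cell j)
      rw [reassoc_of% this]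
      simp only [eqToHom_trans_assoc, eqToHom_refl, Category.id_comp]
    -- the cell `j` acts before the subpath `(bd i).dom`
    · obtain ⟨L', β, hp, h', rfl⟩ := ih hfr hiL (P := (A.comp (bd j).codom).comp C) (P' := P')
        (by simp only [Path.comp_assoc])
      refine ⟨j :: L', _, (hp.cons j).trans (.swap _ _ _), (cons j A ((C.comp (bd i).codom).comp P')
        (h'.congr_left (by simp only [Path.comp_assoc]))).congr_left
          (by simp only [Path.comp_assoc]), ?_⟩
      have := whisker_comp_whisker φ A C P' (cell j) (cell i)
      rw [reassoc_of% this]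

/-- The composite of a pasting does not depend on the order of the cells. -/
theorem unique (hbd : IsEdgeDisjoint bd) {L L' : List ι} {Q Q' : Path s t}
    {α β : compPath φ Q ⟶ compPath φ Q'} (h : IsPasting φ bd cell L Q Q' α)
    (h' : IsPasting φ bd cell L' Q Q' β) (hp : L.Perm L') (hL : IsFresh bd L' Q) : α = β := by
  induction h' generalizing L with
  | nil Q =>
    obtain rfl := hp.eq_nil
    cases h
    rfl
  | cons i P P' h' ih =>
    obtain ⟨L₁, γ, hp', h₁, rfl⟩ := h.exists_cons hbd (hL.perm hp.symm)
      (hp.mem_iff.2 List.mem_cons_self) rfl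
    rw [ih h₁ ((hp'.symm.trans hp).cons_inv) (hL.step hbd)]
    simp

/-- The constructor `cons` for a path pair that equals `bd i` only propositionally. -/
theorem cons_of_eq {bd : ι → G.PathPair} {cell : ∀ i, (bd i).Cell φ} {i : ι}
    {X : G.PathPair} (hX : bd i = X) {x : X.Cell φ} (hx : HEq (cell i) x) (P : Path s X.s)
    (P' : Path X.t t) {L : List ι} {Q' : Path s t}
    {α : compPath φ ((P.comp X.codom).comp P') ⟶ compPath φ Q'}
    (h : IsPasting φ bd cell L ((P.comp X.codom).comp P') Q' α) :
    IsPasting φ bd cell (i :: L) ((P.comp X.dom).comp P') Q' (whisker φ P P' x ≫ α) := by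
  subst hX
  obtain rfl := eq_of_heq hx
  exact cons i P P' h

/-- The image of a pasting under a morphism of graphs. -/
theorem map {K : Graph.{u}} {κ : Type*} {ψ : K.V ⥤q B} (f : G.V ⥤q K.V)
    {bdK : κ → K.PathPair} {cellK : ∀ k, (bdK k).Cell ψ} (g : ι → κ)
    {cell : ∀ i, (bd i).Cell (f ⋙q ψ)}
    (hbd : ∀ i, bdK (g i) = (bd i).map f) (hcell : ∀ i, HEq (cell i) (cellK (g i)))
    {L : List ι} {Q Q' : Path s t} {α : compPath (f ⋙q ψ) Q ⟶ compPath (f ⋙q ψ) Q'}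
    (h : IsPasting (f ⋙q ψ) bd cell L Q Q' α) :
    IsPasting ψ bdK cellK (L.map g) (f.mapPath Q) (f.mapPath Q')
      (eqToHom (compPath_mapPath f ψ Q) ≫ α ≫ eqToHom (compPath_mapPath f ψ Q').symm) := by
  induction h with
  | nil Q =>
    have hc : ∀ {b c : B} {k k' : b ⟶ c} (e : k = k'), 𝟙 k = eqToHom e ≫ 𝟙 k' ≫ eqToHom e.symm := by
      rintro b c k _ rfl
      simp
    exact (hc (compPath_mapPath f ψ Q)) ▸ nil (f.mapPath Q)
  | @cons i P P' L Q' α h ih =>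
    let X := (bd i).map f
    let x : X.Cell ψ := eqToHom (compPath_mapPath f ψ _) ≫ cell i ≫
      eqToHom (compPath_mapPath f ψ _).symm
    have hx : HEq (cellK (g i)) x :=
      (hcell i).symm.trans (heq_eqToHom_comp_comp_eqToHom _ _ _)
    have hm : ∀ q, f.mapPath ((P.comp q).comp P') =
        ((f.mapPath P).comp (f.mapPath q)).comp (f.mapPath P') :=
      fun q => by simp only [Prefunctor.mapPath_comp]
    have h1 := (cons_of_eq (φ := ψ) (bd := bdK) (cell := cellK) (hbd i) hx
      (f.mapPath P) (f.mapPath P') (ih.congr_left (hm _).symm)).congr_left (hm _)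
    -- again for arbitrary 1-cells, so that the `eqToHom`s cancel after substitution
    have hc : ∀ {b c : B} {k k' k'' l l' l'' m m' : b ⟶ c} {v : k' ⟶ l'} {w : k'' ⟶ l''}
        (γ : l' ⟶ m) (e₁ : k = k'') (e₂ : l'' = l) (e₃ : l = l') (e₄ : m = m')
        (e₅ : k'' = k') (e₆ : l' = l'') (e₇ : k = k'),
        w = eqToHom e₅ ≫ v ≫ eqToHom e₆ →
        eqToHom e₁ ≫ w ≫ eqToHom e₂ ≫ eqToHom e₃ ≫ γ ≫ eqToHom e₄ =
          eqToHom e₇ ≫ (v ≫ γ) ≫ eqToHom e₄ := by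
      rintro b c k k' k'' l l' l'' m m' v w γ rfl rfl rfl rfl rfl e₆ e₇ rfl
      simp
    exact (hc _ _ _ _ _ _ _ _ (whisker_mapPath f ψ P P' (cell i))) ▸ h1

end IsPasting

end Sequences

/-! ### Inclusions of anchored graphs -/

/-- An inner point of an edge lies on no other edge. -/
theorem PlaneGraph.curve_injective_left (G : PlaneGraph.{u}) {e f : G.E} {x y : unitInterval}
    (hx0 : x ≠ 0) (hx1 : x ≠ 1) (h : G.curve e x = G.curve f y) : e = f := by
  have h1 := G.isEmbedding.injective h
  -- the points that represent an inner point of an edge form a singleton class of the gluing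
  let t : G.Realization → Prop := Quot.lift (fun z => z = .inr ⟨e, x⟩) (by
    rintro _ _ (⟨f⟩ | ⟨f⟩)
    · simp only [reduceCtorEq, eq_iff_iff, iff_false, Sum.inr.injEq, Sigma.mk.injEq, not_and]
      rintro rfl hh
      exact hx0 (eq_of_heq hh).symm
    · simp only [reduceCtorEq, eq_iff_iff, iff_false, Sum.inr.injEq, Sigma.mk.injEq, not_and]
      rintro rfl hh
      exact hx1 (eq_of_heq hh).symm)
  have h2 : t (Quot.mk _ (.inr ⟨e, x⟩)) = t (Quot.mk _ (.inr ⟨f, y⟩)) := congrArg t h1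
  have h3 : t (Quot.mk _ (.inr ⟨e, x⟩)) := rfl
  rw [h2] at h3
  cases h3
  rfl

theorem PlaneInclusion.onE_injective {G K : PlaneGraph.{u}} (i : PlaneInclusion G K) :
    Function.Injective i.onE := by
  intro e f h
  let x : unitInterval := ⟨1 / 2, by norm_num, by norm_num⟩
  have h1 : i.homeo (G.curve e x) ∈ i.homeo '' Set.range (G.curve f) := by
    rw [i.homeo_curve, ← h, ← i.homeo_curve]
    exact Set.mem_image_of_mem _ (Set.mem_range_self x)
  obtain ⟨_, ⟨y, rfl⟩, hy⟩ := h1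
  refine G.curve_injective_left (x := x) (y := y) ?_ ?_ (i.homeo.injective hy.symm)
  · exact fun h => by norm_num [x, Subtype.ext_iff] at h
  · exact fun h => by norm_num [x, Subtype.ext_iff] at h

theorem PlaneInclusion.edges_mapPath {G K : PlaneGraph.{u}} (i : PlaneInclusion G K) {a b : G.V}
    (p : Path a b) : Graph.edges (i.functor.mapPath p) = (Graph.edges p).map i.onE := by
  induction p with
  | nil => rfl
  | cons p e ih =>
    simp only [Prefunctor.mapPath_cons, Graph.edges, ih, List.map_append, List.map_cons,
      List.map_nil]
    rfl

namespace AnchoredInclusion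

variable {G K : AnchoredGraph.{u}} (i : AnchoredInclusion G K)

theorem onFace_injective : Function.Injective i.onFace := by
  intro F F' h
  exact Subtype.ext (i.homeo.injective.image_injective (congrArg Subtype.val h))

theorem edges_bd_dom (F : G.InteriorFace) :
    Graph.edges (K.bd (i.onFace F)).dom = (Graph.edges (G.bd F).dom).map i.onE := by
  rw [onFace, i.bd_eq F]
  exact i.edges_mapPath _

theorem edges_bd_codom (F : G.InteriorFace) :
    Graph.edges (K.bd (i.onFace F)).codom = (Graph.edges (G.bd F).codom).map i.onE := by
  rw [onFace, i.bd_eq F]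
  exact i.edges_mapPath _

end AnchoredInclusion

/-! ### Disjointness of the faces of a graph with a presentation -/

namespace AnchoredGraph

theorem IsAtomic.eq_face {G : AnchoredGraph.{u}} (hG : G.IsAtomic) (F : G.InteriorFace) :
    F = hG.face :=
  hG.choose_spec.1 F

/-- The face of an atomic graph separates its domain from its codomain: the edges of `dom_F` are
not in `codom_G`, and those of `codom_F` are not in `dom_G`. -/
theorem IsAtomic.disjoint {G : AnchoredGraph.{u}} (hG : G.IsAtomic) (F : G.InteriorFace) :
    List.Disjoint (Graph.edges (G.bd F).dom) (Graph.edges G.ext.codom) ∧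
      List.Disjoint (Graph.edges (G.bd F).codom) (Graph.edges G.ext.dom) := by
  obtain rfl := hG.eq_face F
  obtain ⟨P, P', h1, h2⟩ := hG.exists_paths
  have hd : List.Disjoint (Graph.edges (G.bd hG.face).dom) (Graph.edges (G.bd hG.face).codom) :=
    hG.choose_spec.2
  have n1 := Graph.edges_nodup G.ext_proper.dom_nodup
  have n2 := Graph.edges_nodup G.ext_proper.codom_nodup
  rw [h1] at n1
  rw [h2] at n2
  rw [h1, h2]
  simp only [Graph.edges_comp, List.nodup_append', List.disjoint_append_left,
    List.disjoint_append_right] at n1 n2 ⊢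
  exact ⟨⟨⟨n1.1.2.2.symm, hd⟩, n1.2.2.2⟩, ⟨n2.1.2.2.symm, hd.symm⟩, n2.2.2.2⟩

end AnchoredGraph

namespace VerticalComposite

variable {H G K : AnchoredGraph.{u}} (c : VerticalComposite H G K)

theorem edges_dom :
    Graph.edges K.ext.dom = (Graph.edges G.ext.dom).map c.inl.onE := by
  have := congrArg (fun X => Graph.edges X.dom) c.ext_inl
  exact this.symm.trans (c.inl.edges_mapPath _)

end VerticalComposite

namespace Presentation

theorem disjoint_codom {K : AnchoredGraph.{u}} (p : Presentation K) (F : K.InteriorFace) :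
    List.Disjoint (Graph.edges (K.bd F).codom) (Graph.edges K.ext.dom) := by
  induction p with
  | atomic hK => exact (hK.disjoint F).2
  | @comp H G K c hG p ih =>
    rw [c.edges_dom]
    rcases c.cover_face F with ⟨F, rfl⟩ | ⟨F, rfl⟩
    · rw [c.inl.edges_bd_codom]
      exact List.disjoint_map c.inl.onE_injective (hG.disjoint F).2
    · rw [c.inr.edges_bd_codom]
      intro e h1 h2
      obtain ⟨g, hg, rfl⟩ := List.mem_map.1 h1
      obtain ⟨f, hf, hfg⟩ := List.mem_map.1 h2
      exact ih F hg (c.inter_E _ _ hfg).2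

/-- In `K = H G₁` with `G₁` atomic, the edges of `dom_F` for the face `F` of `G₁` are not in `H`,
and the edges of `codom_F` that are in `H` are in `dom_H`, hence in no codomain of a face of `H`. -/
theorem isEdgeDisjoint {K : AnchoredGraph.{u}} (p : Presentation K) : IsEdgeDisjoint K.bd := by
  suffices h : ∀ F F', F ≠ F' →
      List.Disjoint (Graph.edges (K.bd F).dom) (Graph.edges (K.bd F').dom) ∧
        List.Disjoint (Graph.edges (K.bd F).codom) (Graph.edges (K.bd F').codom) from
    ⟨fun F => (K.bd_proper F).ne, fun F => Graph.edges_nodup (K.bd_proper F).codom_nodup,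
      fun F F' hne => (h F F' hne).1, fun F F' hne => (h F F' hne).2⟩
  induction p with
  | atomic hK => exact fun F F' h => absurd ((hK.eq_face F).trans (hK.eq_face F').symm) h
  | @comp H G K c hG p ih =>
    -- a common edge of `G` and `H` is in `codom_G` and in `dom_H`
    have key : ∀ F F', List.Disjoint (Graph.edges (K.bd (c.inl.onFace F)).dom)
          (Graph.edges (K.bd (c.inr.onFace F')).dom) ∧
        List.Disjoint (Graph.edges (K.bd (c.inl.onFace F)).codom)
          (Graph.edges (K.bd (c.inr.onFace F')).codom) := by
      intro F F'
      rw [c.inl.edges_bd_dom, c.inr.edges_bd_dom, c.inl.edges_bd_codom, c.inr.edges_bd_codom]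
      constructor <;> intro e h1 h2 <;> obtain ⟨f, hf, rfl⟩ := List.mem_map.1 h1 <;>
        obtain ⟨g, hg, hfg⟩ := List.mem_map.1 h2
      · exact (hG.disjoint F).1 hf (c.inter_E _ _ hfg.symm).1
      · exact p.disjoint_codom F' hg (c.inter_E _ _ hfg.symm).2
    intro F F' hne
    rcases c.cover_face F with ⟨F, rfl⟩ | ⟨F, rfl⟩ <;>
      rcases c.cover_face F' with ⟨F', rfl⟩ | ⟨F', rfl⟩
    · exact absurd (by rw [hG.eq_face F, hG.eq_face F']) hne
    · exact key F F'
    · exact (key F' F).imp List.Disjoint.symm List.Disjoint.symm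
    · have := ih F F' (fun h => hne (by rw [h]))
      rw [c.inr.edges_bd_dom, c.inr.edges_bd_dom, c.inr.edges_bd_codom, c.inr.edges_bd_codom]
      exact this.imp (List.disjoint_map c.inr.onE_injective)
        (List.disjoint_map c.inr.onE_injective)

end Presentation

/-! ### The composite of a diagram as a pasting -/

namespace Diagram

variable {B : Type v₁} [Bicategory.{v₃, v₂} B] [Bicategory.Strict B]

theorem isPasting_constituent {G : AnchoredGraph.{u}} (φ : Diagram B G) (hG : G.IsAtomic) :
    IsPasting φ.skel G.bd φ.cell [hG.face] G.ext.dom G.ext.codom (φ.constituent hG) := by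
  have key : ∀ (P : Path G.ext.s (G.bd hG.face).s) (P' : Path (G.bd hG.face).t G.ext.t)
      {Q Q' : Path G.ext.s G.ext.t} (_ : Q = (P.comp (G.bd hG.face).dom).comp P')
      (_ : Q' = (P.comp (G.bd hG.face).codom).comp P')
      (e₁ : compPath φ.skel Q =
        (compPath φ.skel P ≫ compPath φ.skel (G.bd hG.face).dom) ≫ compPath φ.skel P')
      (e₂ : (compPath φ.skel P ≫ compPath φ.skel (G.bd hG.face).codom) ≫ compPath φ.skel P' =
        compPath φ.skel Q'),
      IsPasting φ.skel G.bd φ.cell [hG.face] Q Q' (eqToHom e₁ ≫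
        (compPath φ.skel P ◁ φ.cell hG.face) ▷ compPath φ.skel P' ≫ eqToHom e₂) := by
    rintro P P' _ _ rfl rfl e₁ e₂
    exact IsPasting.single _ P P'
  exact key _ _ hG.exists_paths.choose_spec.choose_spec.1
    hG.exists_paths.choose_spec.choose_spec.2 _ _

/-- A pasting in an anchored graph `G` is a pasting in every graph that includes `G`. -/
theorem isPasting_restrict {G K : AnchoredGraph.{u}} (φ : Diagram B K) (i : AnchoredInclusion G K)
    {L : List G.InteriorFace} {α : G.ext.Cell (φ.restrict i).skel}
    (h : IsPasting (φ.restrict i).skel G.bd (φ.restrict i).cell L G.ext.dom G.ext.codom α)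
    {X : K.PathPair} (hX : G.ext.map i.functor = X)
    (hc : G.ext.Cell (φ.restrict i).skel = X.Cell φ.skel) :
    IsPasting φ.skel K.bd φ.cell (L.map i.onFace) X.dom X.codom (cast hc α) := by
  subst hX
  have := IsPasting.map (ψ := φ.skel) (cellK := φ.cell) i.functor i.onFace (i.bd_eq ·)
    (fun F => cast_heq _ _) h
  have hcast : ∀ {x y : B} {k k' l l' : x ⟶ y} (e₁ : k = k') (e₂ : l' = l)
      (e : (k' ⟶ l') = (k ⟶ l)) (γ : k' ⟶ l'),
      eqToHom e₁ ≫ γ ≫ eqToHom e₂ = cast e γ := by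
    rintro x y k _ l _ rfl rfl e γ
    simp
  exact (hcast _ _ hc α) ▸ this

/-- The composite with respect to a presentation pastes every interior face exactly once. -/
theorem exists_isPasting_composite {K : AnchoredGraph.{u}} (p : Presentation K) (φ : Diagram B K) :
    ∃ L : List K.InteriorFace, L.Nodup ∧ (∀ F, F ∈ L) ∧
      IsPasting φ.skel K.bd φ.cell L K.ext.dom K.ext.codom (composite p φ) := by
  induction p with
  | atomic hK =>
    exact ⟨[hK.face], by simp, fun F => by simp [hK.eq_face F], φ.isPasting_constituent hK⟩
  | @comp H G K c hG p ih =>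
    obtain ⟨L, hn, hL, h⟩ := ih (φ.restrict c.inr)
    refine ⟨[c.inl.onFace hG.face] ++ L.map c.inr.onFace, ?_, fun F => ?_, ?_⟩
    · rw [List.nodup_append']
      refine ⟨by simp, hn.map c.inr.onFace_injective, ?_⟩
      simpa using fun F _ => (c.inter_face hG.face F).symm
    · rcases c.cover_face F with ⟨F, rfl⟩ | ⟨F, rfl⟩
      · simp [hG.eq_face F]
      · exact List.mem_append_right _ (List.mem_map_of_mem (hL F))
    · exact (φ.isPasting_restrict c.inl ((φ.restrict c.inl).isPasting_constituent hG)
        c.ext_inl _).append (φ.isPasting_restrict c.inr h c.ext_inr _)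

end Diagram

end Pasting

theorem mainTheorem4 {B : Type v₁} [Bicategory.{v₃, v₂} B] [Bicategory.Strict B]
    (G : Pasting.AnchoredGraph.{u}) (φ : Pasting.Diagram B G) (p q : Pasting.Presentation G) :
    Pasting.Diagram.composite p φ = Pasting.Diagram.composite q φ := by
  obtain ⟨L, hn, hL, h⟩ := Pasting.Diagram.exists_isPasting_composite p φ
  obtain ⟨L', hn', hL', h'⟩ := Pasting.Diagram.exists_isPasting_composite q φ
  exact h.unique p.isEdgeDisjoint h'
    ((List.perm_ext_iff_of_nodup hn hn').2 fun F => iff_of_true (hL F) (hL' F))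
    ⟨Pasting.Graph.edges_nodup G.ext_proper.dom_nodup, hn', fun F _ => p.disjoint_codom F⟩
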